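/- For a positive integer $k$, a $k$-coloring of the Euclidean plane (an assignment of one of the colors $1,\dots,k$ to every point) is said to have \emph{coloring type} $(d_1,\dots,d_k)$ if, for every $i$, no two points of color $i$ are at distance $d_i$. \begin{enumerate} \item For every $d\in[0.354,\,0.657]$ the plane has a $6$-coloring of type $(1,1,1,1,1,d)$, i.e. one in which five colors avoid unit distance and the sixth color avoids distance $d$. \item There is a family of $6$-colorings of the plane, parameterized by $d$, whose member with parameter $d$ has type $(1,1,1,1,1,d)$ for every $d$ with $0.354\le d\le 0.553$. \item There is a single $6$-coloring of the plane that has type $(1,1,1,1,1,d)$ for all $d\in[0.418,\,0.657]$ simultaneously, i.e. five of its colors avoid unit distance and its sixth color avoids every distance in $[0.418,\,0.657]$. \item The interval $[0.354,\,0.657]$ properly contains the interval $[\sqrt2-1,\,1/\sqrt5]$ (the range for which such colorings were previously known). \end{enumerate} -/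

import Mathlib

/-- The Euclidean plane. -/
abbrev Plane : Type := EuclideanSpace ℝ (Fin 2)

/-- A `k`-coloring `c` of the plane has coloring type `(d₁, …, d_k)` if color `i` does not realize
the distance `dᵢ`: no two points of color `i` are at Euclidean distance `dᵢ`. -/
def HasColoringType {k : ℕ} (c : Plane → Fin k) (d : Fin k → ℝ) : Prop :=
  ∀ i : Fin k, ∀ p q : Plane, c p = i → c q = i → dist p q ≠ d i

/-! Two explicit periodic polygonal tilings, in units of 1/10000, do all the work. In each,
same-colored tiles of the first five colors never realize distance 1. The sixth color avoids [0.354,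
0.418] in one tiling and [0.418, 0.657] in the other. The second gives the simultaneous statement;
switching at 0.418 gives the rest.

What remains is to turn two geometric facts into finite integer checks. Covering
(`EdgeMatched.covered_eq_univ`): if each edge of each triangle is matched from the other side, the
covered set is closed, and open away from the countably many vertices, whose complement is
connected; so it is everything. Convexity and disjointness of tiles are never needed: a point may
take the color of any tile whose hull contains it. Avoidance (`Separated.dist_notMem`): two tiles
are too close if all their vertices are, and too far apart if some direction separates the vertices
enough. Strict inequalities on closed hulls make boundary points harmless, and coordinate bounds
dispose of distant translates. -/

/-- The point of the plane with the given integer coordinates. -/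
noncomputable def toPlane (v : ℤ × ℤ) : Plane := !₂[(v.1 : ℝ), (v.2 : ℝ)]

@[simp] lemma toPlane_zero_apply (v : ℤ × ℤ) : toPlane v 0 = v.1 := by simp [toPlane]

@[simp] lemma toPlane_one_apply (v : ℤ × ℤ) : toPlane v 1 = v.2 := by simp [toPlane]

lemma Plane.ext {p q : Plane} (h₀ : p 0 = q 0) (h₁ : p 1 = q 1) : p = q := by
  ext i
  fin_cases i
  · exact h₀
  · exact h₁

lemma toPlane_add (v w : ℤ × ℤ) : toPlane (v + w) = toPlane v + toPlane w := by
  apply Plane.ext <;> simp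

lemma toPlane_sub (v w : ℤ × ℤ) : toPlane (v - w) = toPlane v - toPlane w := by
  apply Plane.ext <;> simp

lemma dist_sq_plane (p q : Plane) : dist p q ^ 2 = (p 0 - q 0) ^ 2 + (p 1 - q 1) ^ 2 := by
  rw [EuclideanSpace.dist_eq, Real.sq_sqrt (by positivity), Fin.sum_univ_two, Real.dist_eq,
    Real.dist_eq, sq_abs, sq_abs]

/-! ### Oriented areas and triangles -/

/-- Twice the signed area of the triangle `x y p`; positive when `p` is to the left of `xy`. -/
def side (x y : ℤ × ℤ) (p : Plane) : ℝ :=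
  (y.1 - x.1) * (p 1 - x.2) - (y.2 - x.2) * (p 0 - x.1)

/-- Twice the signed area of the triangle `x y z` with integer vertices. -/
def area₂ (x y z : ℤ × ℤ) : ℤ := (y.1 - x.1) * (z.2 - x.2) - (y.2 - x.2) * (z.1 - x.1)

lemma side_toPlane (x y z : ℤ × ℤ) : side x y (toPlane z) = area₂ x y z := by
  simp [side, area₂]

lemma side_swap (x y : ℤ × ℤ) (p : Plane) : side y x p = -side x y p := by
  simp only [side]; ring

lemma side_add (x y v : ℤ × ℤ) (p : Plane) :
    side (x + v) (y + v) (p + toPlane v) = side x y p := by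
  simp [side]

lemma continuous_side (x y : ℤ × ℤ) : Continuous (side x y) := by
  unfold side; fun_prop

/-- The barycentric coordinates of a point with respect to a triangle add up to one. -/
lemma sum_side (x y z : ℤ × ℤ) (p : Plane) :
    side x y p + side y z p + side z x p = area₂ x y z := by
  simp only [side, area₂]; push_cast; ring

/-- Evaluation of an affine function in barycentric coordinates. -/
lemma area₂_mul_side (x y z u v : ℤ × ℤ) (p : Plane) :
    area₂ x y z * side u v p =
      side y z p * side u v (toPlane x) + side z x p * side u v (toPlane y) +
        side x y p * side u v (toPlane z) := by
  simp only [side, area₂, toPlane_zero_apply, toPlane_one_apply]; push_cast; ring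

lemma area₂_smul_eq (x y z : ℤ × ℤ) (p : Plane) :
    (area₂ x y z : ℝ) • p =
      side y z p • toPlane x + side z x p • toPlane y + side x y p • toPlane z := by
  apply Plane.ext <;> simp [side, area₂] <;> ring

/-- The closed triangle with the given vertices in counterclockwise order. -/
def triangle (f : (ℤ × ℤ) × (ℤ × ℤ) × (ℤ × ℤ)) : Set Plane :=
  {p | 0 ≤ side f.1 f.2.1 p ∧ 0 ≤ side f.2.1 f.2.2 p ∧ 0 ≤ side f.2.2 f.1 p}

lemma isClosed_triangle (f : (ℤ × ℤ) × (ℤ × ℤ) × (ℤ × ℤ)) : IsClosed (triangle f) :=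
  (isClosed_le continuous_const (continuous_side _ _)).inter
    ((isClosed_le continuous_const (continuous_side _ _)).inter
      (isClosed_le continuous_const (continuous_side _ _)))

/-- The three `side` values divided by `area₂` are barycentric coordinates. -/
lemma triangle_subset_convexHull {x y z : ℤ × ℤ} (h : 0 < area₂ x y z) :
    triangle (x, y, z) ⊆ convexHull ℝ {toPlane x, toPlane y, toPlane z} := by
  rintro p ⟨h₁, h₂, h₃⟩
  simp only at h₁ h₂ h₃
  have hD : (0 : ℝ) < area₂ x y z := by exact_mod_cast h
  have hs := sum_side x y z p
  have hp : p = (side y z p / area₂ x y z) • toPlane x + (side z x p / area₂ x y z) • toPlane y +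
      (side x y p / area₂ x y z) • toPlane z := by
    rw [div_eq_inv_mul, div_eq_inv_mul, div_eq_inv_mul, mul_smul, mul_smul, mul_smul, ← smul_add,
      ← smul_add, ← area₂_smul_eq, inv_smul_smul₀ hD.ne']
  rw [hp]
  have hc := convex_convexHull ℝ ({toPlane x, toPlane y, toPlane z} : Set Plane)
  have hm : ∀ q ∈ ({toPlane x, toPlane y, toPlane z} : Set Plane),
      q ∈ convexHull ℝ ({toPlane x, toPlane y, toPlane z} : Set Plane) :=
    fun q hq => subset_convexHull ℝ _ hq
  have := hc.sum_mem (t := Finset.univ)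
    (w := ![side y z p / area₂ x y z, side z x p / area₂ x y z, side x y p / area₂ x y z])
    (z := ![toPlane x, toPlane y, toPlane z]) (by
      intro i _; fin_cases i <;> simp <;> positivity)
    (by simp [Fin.sum_univ_three]; field_simp; linarith)
    (by intro i _; apply hm; fin_cases i <;> simp)
  simpa [Fin.sum_univ_three] using this

lemma isCompact_triangle {x y z : ℤ × ℤ} (h : 0 < area₂ x y z) :
    IsCompact (triangle (x, y, z)) :=
  (Set.toFinite {toPlane x, toPlane y, toPlane z}).isCompact_convexHull ℝ |>.of_isClosed_subset
    (isClosed_triangle _) (triangle_subset_convexHull h)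

/-- Two edge lines of a nondegenerate triangle meet only in the common vertex. -/
lemma eq_toPlane_of_side_eq_zero {x y z : ℤ × ℤ} (h : 0 < area₂ x y z) {p : Plane}
    (h₁ : side x y p = 0) (h₂ : side y z p = 0) : p = toPlane y := by
  have hD : (area₂ x y z : ℝ) ≠ 0 := by exact_mod_cast h.ne'
  have hs := sum_side x y z p
  rw [h₁, h₂, zero_add, zero_add] at hs
  have := area₂_smul_eq x y z p
  rw [h₁, h₂, hs, zero_smul, zero_smul, zero_add, add_zero] at this
  exact smul_right_injective _ hD this

/-- Two triangles on opposite sides of a common edge cover a neighbourhood of every point inside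
that edge. -/
lemma eventually_mem_triangle_or {x y z t : ℤ × ℤ} (h : 0 < area₂ x y z) (h' : 0 < area₂ y x t)
    {p : Plane} (h₁ : side x y p = 0) (h₂ : 0 < side y z p) (h₃ : 0 < side z x p) :
    ∀ᶠ q in nhds p, q ∈ triangle (x, y, z) ∨ q ∈ triangle (y, x, t) := by
  have hD : (0 : ℝ) < area₂ x y z := by exact_mod_cast h
  have hD' : (0 : ℝ) < area₂ y x t := by exact_mod_cast h'
  -- The point is strictly between x and y, and this affine function vanishes at x and is positive
  -- at y.
  have h₄ : 0 < side x t p := by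
    have e := area₂_mul_side x y z x t p
    have a₁ : area₂ x t x = 0 := by simp [area₂]
    have a₂ : area₂ x t y = area₂ y x t := by simp only [area₂]; ring
    rw [h₁, side_toPlane, side_toPlane, a₁, a₂] at e
    refine pos_of_mul_pos_right (a := (area₂ x y z : ℝ)) ?_ hD.le
    rw [e]; simp; positivity
  have h₅ : 0 < side t y p := by
    have e := area₂_mul_side x y z t y p
    have a₁ : area₂ t y x = area₂ y x t := by simp only [area₂]; ring
    have a₂ : area₂ t y y = 0 := by simp only [area₂]; ring
    rw [h₁, side_toPlane, side_toPlane, a₁, a₂] at e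
    refine pos_of_mul_pos_right (a := (area₂ x y z : ℝ)) ?_ hD.le
    rw [e]; simp; positivity
  filter_upwards [(continuous_side y z).continuousAt.eventually (lt_mem_nhds h₂),
    (continuous_side z x).continuousAt.eventually (lt_mem_nhds h₃),
    (continuous_side x t).continuousAt.eventually (lt_mem_nhds h₄),
    (continuous_side t y).continuousAt.eventually (lt_mem_nhds h₅)] with q e₂ e₃ e₄ e₅
  rcases le_total 0 (side x y q) with e | e
  · exact Or.inl ⟨e, e₂.le, e₃.le⟩
  · refine Or.inr ⟨?_, e₄.le, e₅.le⟩
    rw [side_swap]; simpa using e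

/-! ### Periodic tilings and covering by matched edges -/

/-- A family of colored polygons with integer vertices, repeated along the lattice generated by
`(width, 0)` and `(shift, height)`. -/
structure PeriodicTiling where
  width : ℤ
  shift : ℤ
  height : ℤ
  tiles : List (Fin 6 × List (ℤ × ℤ))

/-- The triangles from the first vertex of a convex polygon to its other edges, each of them listed
once for every choice of a distinguished edge. -/
def fan : List (ℤ × ℤ) → List ((ℤ × ℤ) × (ℤ × ℤ) × (ℤ × ℤ))
  | [] => []
  | z :: l => (l.zip l.tail).flatMap fun e => [(z, e.1, e.2), (e.1, e.2, z), (e.2, z, e.1)]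

lemma rotate_mem_fan {l : List (ℤ × ℤ)} {x y z : ℤ × ℤ} (h : (x, y, z) ∈ fan l) :
    (y, z, x) ∈ fan l := by
  cases l with
  | nil => simp [fan] at h
  | cons o l =>
    simp only [fan, List.mem_flatMap] at h ⊢
    obtain ⟨e, he, h⟩ := h
    refine ⟨e, he, ?_⟩
    simp only [List.mem_cons, Prod.mk.injEq, List.not_mem_nil, or_false] at h ⊢
    tauto

lemma mem_of_mem_fan {l : List (ℤ × ℤ)} {x y z : ℤ × ℤ} (h : (x, y, z) ∈ fan l) :
    x ∈ l ∧ y ∈ l ∧ z ∈ l := by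
  cases l with
  | nil => simp [fan] at h
  | cons o l =>
    simp only [fan, List.mem_flatMap] at h
    obtain ⟨⟨u, v⟩, he, h⟩ := h
    have hu := (List.of_mem_zip he).1
    have hv := List.mem_of_mem_tail (List.of_mem_zip he).2
    simp only [List.mem_cons, Prod.mk.injEq, List.not_mem_nil, or_false] at h ⊢
    rcases h with ⟨rfl, rfl, rfl⟩ | ⟨rfl, rfl, rfl⟩ | ⟨rfl, rfl, rfl⟩ <;> tauto

/-- The convex hull of a list of integer points. -/
def hull (l : List (ℤ × ℤ)) : Set Plane := convexHull ℝ (toPlane '' {v | v ∈ l})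

/-- The integers of absolute value at most `n`. -/
def symmRange (n : ℕ) : List ℤ := (List.range (2 * n + 1)).map fun i : ℕ => (i : ℤ) - n

lemma mem_symmRange {n : ℕ} {a : ℤ} : a ∈ symmRange n ↔ |a| ≤ n := by
  simp only [symmRange, List.mem_map, List.mem_range, abs_le]
  constructor
  · rintro ⟨i, hi, rfl⟩; omega
  · rintro ⟨h₁, h₂⟩; exact ⟨(a + n).toNat, by omega, by omega⟩

namespace PeriodicTiling

variable (P : PeriodicTiling)

/-- The lattice vector with the given coordinates. -/
def period (a b : ℤ) : ℤ × ℤ := (a * P.width + b * P.shift, b * P.height)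

lemma period_add (a b a' b' : ℤ) : P.period (a + a') (b + b') = P.period a b + P.period a' b' := by
  simp only [period, Prod.mk_add_mk]; ext <;> ring

lemma toPlane_period_zero : toPlane (P.period 0 0) = 0 := by
  apply Plane.ext <;> simp [period]

lemma period_sub (a b a' b' : ℤ) : P.period (a - a') (b - b') = P.period a b - P.period a' b' := by
  simp only [period, Prod.mk_sub_mk]; ext <;> ring

/-- All triangles of the fans of the tiles. -/
def flags : List ((ℤ × ℤ) × (ℤ × ℤ) × (ℤ × ℤ)) := P.tiles.flatMap fun t => fan t.2

/-- The union of all translates of all triangles. -/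
def covered : Set Plane :=
  {p | ∃ f ∈ P.flags, ∃ a b : ℤ, p - toPlane (P.period a b) ∈ triangle f}

/-- The vertices of all translates of all triangles. -/
def vertices : Set Plane :=
  {p | ∃ f ∈ P.flags, ∃ a b : ℤ, p = toPlane (f.1 + P.period a b)}

/-- The triangles are nondegenerate, and every edge of a triangle is matched by the same edge, in
the opposite direction, of a translate of another triangle. -/
structure EdgeMatched (n : ℕ) : Prop where
  width_pos : 0 < P.width
  height_pos : 0 < P.height
  ne_nil : P.flags ≠ []
  area_pos : ∀ f ∈ P.flags, 0 < area₂ f.1 f.2.1 f.2.2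
  exists_match : ∀ f ∈ P.flags, ∃ g ∈ P.flags, g.1 - g.2.1 = f.2.1 - f.1 ∧
    ∃ a ∈ symmRange n, ∃ b ∈ symmRange n, f.1 = g.2.1 + P.period a b

variable {P}

lemma rotate_mem_flags {x y z : ℤ × ℤ} (h : (x, y, z) ∈ P.flags) : (y, z, x) ∈ P.flags := by
  simp only [flags, List.mem_flatMap] at h ⊢
  obtain ⟨t, ht, h⟩ := h
  exact ⟨t, ht, rotate_mem_fan h⟩

lemma countable_vertices : P.vertices.Countable := by
  have : P.vertices ⊆ Set.range toPlane := by
    rintro p ⟨f, -, a, b, rfl⟩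
    exact ⟨_, rfl⟩
  exact (Set.countable_range _).mono this

lemma isClosed_periods (hw : 0 < P.width) (hh : 0 < P.height) :
    IsClosed {p | ∃ a b : ℤ, p = toPlane (P.period a b)} := by
  have hw' : (P.width : ℝ) ≠ 0 := by exact_mod_cast hw.ne'
  have hh' : (P.height : ℝ) ≠ 0 := by exact_mod_cast hh.ne'
  -- Being a lattice point means that two continuous coordinates are integers.
  have hZ : IsClosed (Set.range ((↑) : ℤ → ℝ)) := Int.isClosedEmbedding_coe_real.isClosed_range
  have h₁ : Continuous fun p : Plane => (p 0 - p 1 / P.height * P.shift) / P.width := by fun_prop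
  have h₂ : Continuous fun p : Plane => p 1 / P.height := by fun_prop
  convert (hZ.preimage h₁).inter (hZ.preimage h₂) using 1
  ext p
  constructor
  · rintro ⟨a, b, rfl⟩
    refine ⟨⟨a, ?_⟩, ⟨b, ?_⟩⟩ <;> simp [period] <;> field_simp
    ring
  · rintro ⟨⟨a, ha⟩, ⟨b, hb⟩⟩
    simp only at ha hb
    refine ⟨a, b, Plane.ext ?_ ?_⟩
    · rw [← hb, eq_div_iff hw'] at ha
      simp [period]; linarith
    · rw [eq_div_iff hh'] at hb
      simp [period, hb]

/-- The covered set is a compact set plus a closed one: finitely many triangles plus the lattice. -/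
lemma EdgeMatched.isClosed_covered {n : ℕ} (h : P.EdgeMatched n) : IsClosed P.covered := by
  have hK : IsCompact (⋃ f ∈ {f | f ∈ P.flags}, triangle f) :=
    P.flags.finite_toSet.isCompact_biUnion fun f hf => isCompact_triangle (h.area_pos f hf)
  convert (isClosed_periods h.width_pos h.height_pos).add_left_of_isCompact hK using 1
  ext p
  simp only [covered, Set.mem_add, Set.mem_iUnion, Set.mem_ofPred_eq, exists_prop]
  constructor
  · rintro ⟨f, hf, a, b, hp⟩
    exact ⟨_, ⟨f, hf, hp⟩, _, ⟨a, b, rfl⟩, sub_add_cancel _ _⟩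
  · rintro ⟨q, ⟨f, hf, hq⟩, _, ⟨a, b, rfl⟩, rfl⟩
    exact ⟨f, hf, a, b, by rwa [add_sub_cancel_right]⟩

lemma sub_mem_covered {p : Plane} (a b : ℤ) (h : p - toPlane (P.period a b) ∈ P.covered) :
    p ∈ P.covered := by
  obtain ⟨f, hf, a', b', h⟩ := h
  refine ⟨f, hf, a + a', b + b', ?_⟩
  rwa [period_add, toPlane_add, ← sub_sub]

lemma triangle_translate (x y z v : ℤ × ℤ) (q : Plane) :
    q ∈ triangle (x + v, y + v, z + v) ↔ q - toPlane v ∈ triangle (x, y, z) := by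
  have key : ∀ u w : ℤ × ℤ, side (u + v) (w + v) q = side u w (q - toPlane v) := fun u w => by
    rw [← side_add u w v (q - toPlane v), sub_add_cancel]
  simp only [triangle, Set.mem_ofPred_eq, key]

/-- Points inside a distinguished edge are in the interior of the covered set. -/
lemma EdgeMatched.eventually_of_edge {n : ℕ} (h : P.EdgeMatched n) {x y z : ℤ × ℤ}
    (hf : (x, y, z) ∈ P.flags) {p : Plane} (h₁ : side x y p = 0) (h₂ : 0 < side y z p)
    (h₃ : 0 < side z x p) : ∀ᶠ q in nhds p, q ∈ P.covered := by
  obtain ⟨⟨u, v, w⟩, hg, e, a, -, b, -, e'⟩ := h.exists_match _ hf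
  simp only at e e'
  have e'' : y = u + P.period a b := by
    rw [← sub_add_cancel y x, ← e, e']; abel
  have harea : 0 < area₂ y x (w + P.period a b) := by
    have := h.area_pos _ hg
    rw [e', e'']
    simpa [area₂] using this
  filter_upwards [eventually_mem_triangle_or (h.area_pos _ hf) harea h₁ h₂ h₃] with q hq
  rcases hq with hq | hq
  · exact ⟨_, hf, 0, 0, by rwa [toPlane_period_zero, sub_zero]⟩
  · rw [e', e'', triangle_translate] at hq
    exact ⟨_, hg, a, b, hq⟩

/-- A non-vertex point of a triangle is in its interior or strictly inside one edge, where the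
matched triangle fills the other side. -/
lemma EdgeMatched.covered_diff_subset {n : ℕ} (h : P.EdgeMatched n) :
    P.covered \ P.vertices ⊆ interior P.covered := by
  rintro p ⟨⟨⟨x, y, z⟩, hf, a, b, hp⟩, hv⟩
  set p' := p - toPlane (P.period a b) with hp'
  have key : ∀ᶠ q in nhds p', q ∈ P.covered := by
    have hf₁ := rotate_mem_flags hf
    have hf₂ := rotate_mem_flags hf₁
    have hx : p' ≠ toPlane x := fun e => hv ⟨_, hf, a, b, by
      rw [toPlane_add, ← e, hp', sub_add_cancel]⟩
    have hy : p' ≠ toPlane y := fun e => hv ⟨_, hf₁, a, b, by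
      rw [toPlane_add, ← e, hp', sub_add_cancel]⟩
    have hz : p' ≠ toPlane z := fun e => hv ⟨_, hf₂, a, b, by
      rw [toPlane_add, ← e, hp', sub_add_cancel]⟩
    obtain ⟨h₁, h₂, h₃⟩ := hp
    simp only at h₁ h₂ h₃
    rcases h₁.eq_or_lt with h₁ | h₁
    · refine h.eventually_of_edge hf h₁.symm (h₂.lt_of_ne fun e => hy ?_)
        (h₃.lt_of_ne fun e => hx ?_)
      · exact eq_toPlane_of_side_eq_zero (h.area_pos _ hf) h₁.symm e.symm
      · exact eq_toPlane_of_side_eq_zero (h.area_pos _ hf₂) e.symm h₁.symm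
    rcases h₂.eq_or_lt with h₂ | h₂
    · refine h.eventually_of_edge hf₁ h₂.symm (h₃.lt_of_ne fun e => hz ?_) h₁
      exact eq_toPlane_of_side_eq_zero (h.area_pos _ hf₁) h₂.symm e.symm
    rcases h₃.eq_or_lt with h₃ | h₃
    · exact h.eventually_of_edge hf₂ h₃.symm h₁ h₂
    filter_upwards [(continuous_side x y).continuousAt.eventually (lt_mem_nhds h₁),
      (continuous_side y z).continuousAt.eventually (lt_mem_nhds h₂),
      (continuous_side z x).continuousAt.eventually (lt_mem_nhds h₃)] with q e₁ e₂ e₃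
    exact ⟨_, hf, 0, 0, by
      rw [toPlane_period_zero, sub_zero]; exact ⟨e₁.le, e₂.le, e₃.le⟩⟩
  have hc : Filter.Tendsto (fun q => q - toPlane (P.period a b)) (nhds p) (nhds p') :=
    (continuous_id.sub continuous_const).tendsto p
  exact mem_interior_iff_mem_nhds.2 ((hc.eventually key).mono fun q hq => sub_mem_covered a b hq)

/-- An edge-matched family of triangles covers the plane: away from the countably many vertices, the
covered set is both open and closed, and the complement of a countable set is connected. -/
theorem EdgeMatched.covered_eq_univ {n : ℕ} (h : P.EdgeMatched n) : P.covered = Set.univ := by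
  have hrank : 1 < Module.rank ℝ Plane := by
    rw [← Module.finrank_eq_rank, finrank_euclideanSpace_fin]; norm_num
  have hconn := (countable_vertices (P := P)).isConnected_compl_of_one_lt_rank hrank
  have hdense := (countable_vertices (P := P)).dense_compl ℝ
  have hne : (interior P.covered).Nonempty := by
    obtain ⟨⟨x, y, z⟩, hf⟩ := List.exists_mem_of_ne_nil _ h.ne_nil
    have hD : (0 : ℝ) < area₂ x y z := by exact_mod_cast h.area_pos _ hf
    set p : Plane := (1 / 2 : ℝ) • (toPlane x + toPlane y) with hp
    refine ⟨p, mem_interior_iff_mem_nhds.2 (h.eventually_of_edge hf ?_ ?_ ?_)⟩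
    · simp [side, hp]; ring
    · have : side y z p = area₂ x y z / 2 := by simp [side, hp, area₂]; ring
      rw [this]; positivity
    · have : side z x p = area₂ x y z / 2 := by simp [side, hp, area₂]; ring
      rw [this]; positivity
  by_contra hcov
  have hopen : IsOpen P.coveredᶜ := h.isClosed_covered.isOpen_compl
  obtain ⟨p, -, hi, hc⟩ := hconn.isPreconnected (interior P.covered) P.coveredᶜ isOpen_interior hopen
    (fun q hq => by
      by_cases hqc : q ∈ P.covered
      · exact Or.inl (h.covered_diff_subset ⟨hqc, hq⟩)
      · exact Or.inr hqc)
    (hdense.inter_open_nonempty _ isOpen_interior hne |>.mono fun q hq => ⟨hq.2, hq.1⟩)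
    (hdense.inter_open_nonempty _ hopen (Set.nonempty_compl.2 hcov)
      |>.mono fun q hq => ⟨hq.2, hq.1⟩)
  exact hc (interior_subset hi)

end PeriodicTiling

/-! ### Distances between convex hulls -/

/-- A linear functional that separates the vertices separates the convex hulls. -/
lemma lt_of_mem_hull {s t : List (ℤ × ℤ)} {φ : Plane →ₗ[ℝ] ℝ} {r : ℝ}
    (h : ∀ v ∈ s, ∀ w ∈ t, r < φ (toPlane w - toPlane v)) {p q : Plane} (hp : p ∈ hull s)
    (hq : q ∈ hull t) : r < φ (q - p) := by
  have h₁ : ∀ v ∈ s, r < φ (q - toPlane v) := by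
    intro v hv
    have hc := convex_halfSpace_gt φ.isLinear (r + φ (toPlane v))
    have : hull t ⊆ {w | r + φ (toPlane v) < φ w} := convexHull_min (by
      rintro _ ⟨w, hw, rfl⟩
      have := h v hv w hw
      rw [map_sub] at this
      simp only [Set.mem_ofPred_eq]; linarith) hc
    have := this hq
    simp only [Set.mem_ofPred_eq] at this
    rw [map_sub]; linarith
  have hc := convex_halfSpace_lt φ.isLinear (φ q - r)
  have : hull s ⊆ {w | φ w < φ q - r} := convexHull_min (by
    rintro _ ⟨v, hv, rfl⟩
    have := h₁ v hv
    rw [map_sub] at this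
    simp only [Set.mem_ofPred_eq]; linarith) hc
  have := this hp
  simp only [Set.mem_ofPred_eq] at this
  rw [map_sub]; linarith

/-- The scalar product with an integer vector. -/
def scalarProduct (n : ℤ × ℤ) : Plane →ₗ[ℝ] ℝ where
  toFun p := n.1 * p 0 + n.2 * p 1
  map_add' p q := by simp; ring
  map_smul' c p := by simp; ring

/-- In direction `n`, all points of `t` shifted by `v` are farther than `r` from all points
of `s`. -/
abbrev SeparatedAlong (r : ℤ) (s t : List (ℤ × ℤ)) (v n : ℤ × ℤ) : Prop :=
  ∀ x ∈ s, ∀ y ∈ t, 0 < n.1 * (y.1 + v.1 - x.1) + n.2 * (y.2 + v.2 - x.2) ∧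
    r * r * (n.1 * n.1 + n.2 * n.2) <
      (n.1 * (y.1 + v.1 - x.1) + n.2 * (y.2 + v.2 - x.2)) *
        (n.1 * (y.1 + v.1 - x.1) + n.2 * (y.2 + v.2 - x.2))

lemma SeparatedAlong.lt_dist {r : ℤ} {s t : List (ℤ × ℤ)} {v n : ℤ × ℤ}
    (h : SeparatedAlong r s t v n) {p q : Plane} (hp : p ∈ hull s) (hq : q ∈ hull t) :
    r < dist p (q + toPlane v) := by
  have key : (r : ℝ) * √(n.1 ^ 2 + n.2 ^ 2) - scalarProduct n (toPlane v) <
      scalarProduct n (q - p) := by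
    refine lt_of_mem_hull (fun x hx y hy => ?_) hp hq
    obtain ⟨h₁, h₂⟩ := h x hx y hy
    have e : ((n.1 * (y.1 + v.1 - x.1) + n.2 * (y.2 + v.2 - x.2) : ℤ) : ℝ) =
        scalarProduct n (toPlane y - toPlane x) + scalarProduct n (toPlane v) := by
      simp [scalarProduct]; ring
    rw [sub_lt_iff_lt_add, ← e]
    -- Squaring keeps the check in the integers; the sign condition in `SeparatedAlong` allows the
    -- root to be taken.
    refine lt_of_pow_lt_pow_left₀ 2 (by exact_mod_cast h₁.le) ?_
    rw [mul_pow, Real.sq_sqrt (by positivity)]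
    have : ((r * r * (n.1 * n.1 + n.2 * n.2) : ℤ) : ℝ) < _ := Int.cast_lt.2 h₂
    push_cast at this ⊢
    linarith
  set z := q + toPlane v - p with hz
  have e : scalarProduct n (q - p) + scalarProduct n (toPlane v) = n.1 * z 0 + n.2 * z 1 := by
    rw [← map_add]; simp [scalarProduct, hz]; ring
  rw [sub_lt_iff_lt_add, e] at key
  have hd : dist p (q + toPlane v) = √(z 0 ^ 2 + z 1 ^ 2) := by
    rw [eq_comm, Real.sqrt_eq_iff_eq_sq (by positivity) dist_nonneg, dist_sq_plane]
    simp [hz]; ring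
  rw [hd]
  have cauchy : (n.1 : ℝ) * z 0 + n.2 * z 1 ≤ √(z 0 ^ 2 + z 1 ^ 2) * √(n.1 ^ 2 + n.2 ^ 2) := by
    rw [← Real.sqrt_mul (by positivity)]
    apply Real.le_sqrt_of_sq_le
    nlinarith [sq_nonneg ((n.1 : ℝ) * z 1 - n.2 * z 0)]
  exact lt_of_mul_lt_mul_right (key.trans_le cauchy) (Real.sqrt_nonneg _)

lemma dist_lt_of_mem_hull {r : ℤ} (hr : 0 ≤ r) {s t : List (ℤ × ℤ)}
    (h : ∀ x ∈ s, ∀ y ∈ t,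
      (x.1 - y.1) * (x.1 - y.1) + (x.2 - y.2) * (x.2 - y.2) < r * r) {p q : Plane}
    (hp : p ∈ hull s) (hq : q ∈ hull t) : dist p q < r := by
  -- The distance between points of two hulls is at most that of some pair of vertices.
  obtain ⟨_, ⟨x, hx, rfl⟩, _, ⟨y, hy, rfl⟩, hd⟩ := convexHull_exists_dist_ge2 hp hq
  refine hd.trans_lt (lt_of_pow_lt_pow_left₀ 2 (by exact_mod_cast hr) ?_)
  rw [dist_sq_plane]
  have : (((x.1 - y.1) * (x.1 - y.1) + (x.2 - y.2) * (x.2 - y.2) : ℤ) : ℝ) < _ :=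
    Int.cast_lt.2 (h x hx y hy)
  push_cast at this
  simp only [toPlane_zero_apply, toPlane_one_apply]
  linarith

/-- Candidate directions for separating `s` from `t` shifted by `v`: the axes and the differences of
vertices. -/
def directions (s t : List (ℤ × ℤ)) (v : ℤ × ℤ) : List (ℤ × ℤ) :=
  [(1, 0), (-1, 0), (0, 1), (0, -1)] ++ s.flatMap fun x => t.map fun y => y + v - x

/-- No point of `s` and point of `t` shifted by `v` are at a distance in `[r.1, r.2]`. -/
abbrev AvoidsDistances (r : ℤ × ℤ) (s t : List (ℤ × ℤ)) (v : ℤ × ℤ) : Prop :=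
  (v = 0 ∧ ∀ x ∈ s, ∀ y ∈ t,
      (x.1 - y.1) * (x.1 - y.1) + (x.2 - y.2) * (x.2 - y.2) < r.1 * r.1) ∨
    ∃ n ∈ directions s t v, SeparatedAlong r.2 s t v n

lemma AvoidsDistances.dist_notMem {r : ℤ × ℤ} (hr : 0 ≤ r.1) {s t : List (ℤ × ℤ)} {v : ℤ × ℤ}
    (h : AvoidsDistances r s t v) {p q : Plane} (hp : p ∈ hull s) (hq : q ∈ hull t) :
    dist p (q + toPlane v) ∉ Set.Icc (r.1 : ℝ) r.2 := by
  rintro ⟨h₁, h₂⟩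
  rcases h with ⟨rfl, h⟩ | ⟨n, -, h⟩
  · have hv : toPlane 0 = 0 := by apply Plane.ext <;> simp
    rw [hv, add_zero] at h₁
    exact absurd (dist_lt_of_mem_hull hr h hp hq) h₁.not_gt
  · exact absurd (h.lt_dist hp hq) h₂.not_gt

/-! ### From finite checks to colorings -/

namespace PeriodicTiling

variable {P : PeriodicTiling}

lemma exists_mem_hull (hP : ∃ n, P.EdgeMatched n) (p : Plane) :
    ∃ t ∈ P.tiles, ∃ a b : ℤ, p - toPlane (P.period a b) ∈ hull t.2 := by
  obtain ⟨n, hP⟩ := hP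
  obtain ⟨⟨x, y, z⟩, hf, a, b, hp⟩ : p ∈ P.covered := hP.covered_eq_univ ▸ Set.mem_univ p
  obtain ⟨t, ht, hf'⟩ := List.mem_flatMap.1 hf
  refine ⟨t, ht, a, b, convexHull_mono ?_ (triangle_subset_convexHull (hP.area_pos _ hf) hp)⟩
  obtain ⟨hx, hy, hz⟩ := mem_of_mem_fan hf'
  rintro _ (rfl | rfl | rfl) <;> exact Set.mem_image_of_mem _ ‹_›

variable (P) in
/-- Tiles of color `i` and their translates do not realize distances in
`[(forbidden i).1, (forbidden i).2]`. The first conditions show that only finitely many translates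
matter. -/
structure Separated (forbidden : Fin 6 → ℤ × ℤ) (m n : ℕ) : Prop where
  width_pos : 0 < P.width
  height_pos : 0 < P.height
  forbidden_nonneg : ∀ i, 0 ≤ (forbidden i).1
  lt_height : ∀ s ∈ P.tiles, ∀ t ∈ P.tiles, s.1 = t.1 → ∀ x ∈ s.2, ∀ y ∈ t.2,
    (forbidden s.1).2 + (y.2 - x.2) < (n + 1) * P.height
  lt_width : ∀ s ∈ P.tiles, ∀ t ∈ P.tiles, s.1 = t.1 → ∀ x ∈ s.2, ∀ y ∈ t.2,
    (forbidden s.1).2 + (y.1 - x.1) + n * |P.shift| < (m + 1) * P.width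
  avoids : ∀ s ∈ P.tiles, ∀ t ∈ P.tiles, s.1 = t.1 → ∀ a ∈ symmRange m, ∀ b ∈ symmRange n,
    AvoidsDistances (forbidden s.1) s.2 t.2 (P.period a b)

lemma Separated.sub_lt {forbidden : Fin 6 → ℤ × ℤ} {m n : ℕ} (h : P.Separated forbidden m n)
    {s t : Fin 6 × List (ℤ × ℤ)} (hs : s ∈ P.tiles) (ht : t ∈ P.tiles) (hst : s.1 = t.1)
    {p q : Plane} (hp : p ∈ hull s.2) (hq : q ∈ hull t.2) :
    (forbidden s.1).2 + (q 1 - p 1) < (n + 1) * P.height ∧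
      (forbidden s.1).2 + (q 0 - p 0) + n * |(P.shift : ℝ)| < (m + 1) * P.width := by
  constructor
  · have := lt_of_mem_hull (φ := scalarProduct (0, -1))
      (r := (forbidden s.1).2 - (n + 1) * P.height) (fun x hx y hy => by
        have : (((forbidden s.1).2 + (y.2 - x.2) : ℤ) : ℝ) < _ :=
          Int.cast_lt.2 (h.lt_height s hs t ht hst x hx y hy)
        push_cast at this
        simp [scalarProduct]; linarith) hp hq
    simp [scalarProduct] at this
    linarith
  · have := lt_of_mem_hull (φ := scalarProduct (-1, 0))
      (r := (forbidden s.1).2 + n * |(P.shift : ℝ)| - (m + 1) * P.width) (fun x hx y hy => by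
        have : (((forbidden s.1).2 + (y.1 - x.1) + n * |P.shift| : ℤ) : ℝ) < _ :=
          Int.cast_lt.2 (h.lt_width s hs t ht hst x hx y hy)
        push_cast at this
        simp [scalarProduct]; linarith) hp hq
    simp [scalarProduct] at this
    linarith

lemma Separated.dist_notMem {forbidden : Fin 6 → ℤ × ℤ} {m n : ℕ} (h : P.Separated forbidden m n)
    {s t : Fin 6 × List (ℤ × ℤ)} (hs : s ∈ P.tiles) (ht : t ∈ P.tiles) (hst : s.1 = t.1)
    (a b : ℤ) {p q : Plane} (hp : p ∈ hull s.2) (hq : q ∈ hull t.2) :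
    dist p (q + toPlane (P.period a b)) ∉
      Set.Icc ((forbidden s.1).1 : ℝ) (forbidden s.1).2 := by
  by_cases hab : |a| ≤ m ∧ |b| ≤ n
  · exact (h.avoids s hs t ht hst a (mem_symmRange.2 hab.1) b (mem_symmRange.2 hab.2)).dist_notMem
      (h.forbidden_nonneg _) hp hq
  rintro ⟨-, hd⟩
  obtain ⟨u₁, u₂⟩ := h.sub_lt hs ht hst hp hq
  -- Exchanging the tiles bounds the translation from the opposite side.
  obtain ⟨v₁, v₂⟩ := h.sub_lt ht hs hst.symm hq hp
  rw [← hst] at v₁ v₂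
  have hr := dist_nonneg.trans hd
  have hd2 := pow_le_pow_left₀ dist_nonneg hd 2
  rw [dist_sq_plane] at hd2
  have e₀ := abs_le_of_sq_le_sq' (hd2.trans' (le_add_of_nonneg_right (sq_nonneg _))) hr
  have e₁ := abs_le_of_sq_le_sq' (hd2.trans' (le_add_of_nonneg_left (sq_nonneg _))) hr
  simp only [PiLp.add_apply, toPlane_zero_apply, toPlane_one_apply, period, Int.cast_add,
    Int.cast_mul] at e₀ e₁
  obtain ⟨e₀, e₀'⟩ := e₀
  obtain ⟨e₁, e₁'⟩ := e₁
  have i₁ : |b * P.height| < (n + 1) * P.height := by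
    have : |(b * P.height : ℝ)| < (n + 1) * P.height := abs_lt.2 ⟨by linarith, by linarith⟩
    exact_mod_cast this
  have i₂ : |a * P.width + b * P.shift| + n * |P.shift| < (m + 1) * P.width := by
    have : |(a * P.width + b * P.shift : ℝ)| < (m + 1) * P.width - n * |(P.shift : ℝ)| :=
      abs_lt.2 ⟨by linarith, by linarith⟩
    rw [lt_sub_iff_add_lt] at this
    exact_mod_cast this
  have hb : |b| ≤ n := by
    rw [abs_mul, abs_of_pos h.height_pos] at i₁
    have := lt_of_mul_lt_mul_right i₁ h.height_pos.le
    omega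
  -- The row index must be bounded first: only then is the horizontal drift at most n times |shift|,
  -- as `lt_width` allows for.
  refine hab ⟨?_, hb⟩
  have i₃ : |a * P.width| < (m + 1) * P.width := by
    have j := abs_sub (a * P.width + b * P.shift) (b * P.shift)
    rw [add_sub_cancel_right, abs_mul b] at j
    have := mul_le_mul_of_nonneg_right hb (abs_nonneg P.shift)
    linarith
  rw [abs_mul, abs_of_pos h.width_pos] at i₃
  have := lt_of_mul_lt_mul_right i₃ h.width_pos.le
  omega

/-- The coloring given by a periodic tiling with coordinates in units of `1 / 10000`. -/
theorem exists_coloring {lo hi : ℤ} {l m n : ℕ} (hP : P.EdgeMatched l)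
    (h : P.Separated (fun i => if i = 5 then (lo, hi) else (10000, 10000)) m n) :
    ∃ c : Plane → Fin 6, ∀ d ∈ Set.Icc (lo / 10000 : ℝ) (hi / 10000),
      HasColoringType c ![1, 1, 1, 1, 1, d] := by
  choose tile htile a b hab using fun p : Plane => exists_mem_hull ⟨l, hP⟩ ((10000 : ℝ) • p)
  refine ⟨fun p => (tile p).1, fun d hd i p q hp hq hpq => ?_⟩
  -- Both points are reduced to listed tiles, so the difference of their periods restores their
  -- relative position.
  have key := h.dist_notMem (htile p) (htile q) (hp.trans hq.symm) (a q - a p) (b q - b p) (hab p)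
    (hab q)
  have e : dist ((10000 : ℝ) • p - toPlane (P.period (a p) (b p)))
      ((10000 : ℝ) • q - toPlane (P.period (a q) (b q)) +
        toPlane (P.period (a q - a p) (b q - b p))) = 10000 * dist p q := by
    rw [period_sub, toPlane_sub, sub_add_sub_cancel, dist_sub_right, dist_smul₀]
    norm_num
  simp only at hp hq
  rw [e, hpq, hp] at key
  refine key ?_
  obtain ⟨h₁, h₂⟩ := hd
  rw [div_le_iff₀ (by norm_num)] at h₁
  rw [le_div_iff₀ (by norm_num)] at h₂
  fin_cases i <;> simp
  exact ⟨by linarith, by linarith⟩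

end PeriodicTiling

/-! ### The two tilings and their verification -/

/-- A tiling whose tiles of color `5` have diameter below `0.354` and mutual distances above
`0.418`, in units of `10000`. -/
def sixColoringNarrow : PeriodicTiling where
  width := 19228
  shift := 9372
  height := 16772
  tiles := [
    (0, [(2397, -3769), (7534, -8128), (9677, -8341), (11449, -4521), (11729, -1998),
      (9586, 1627), (7827, 1454), (2508, -2773)]),
    (1, [(7669, 4895), (7829, 4664), (10942, 3068), (16895, 5661), (16906, 8644),
      (11769, 13003), (9151, 11939)]),
    (2, [(-179, 8431), (803, 7049), (7669, 4895), (9151, 11939), (8408, 13493), (4208, 13793),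
      (1593, 12251)]),
    (3, [(-9642, 1627), (-7499, -1998), (-5164, -2979), (-964, -3279), (-121, -1326),
      (-1386, 5263), (-2333, 5661), (-8286, 3068)]),
    (4, [(-121, -1326), (2508, -2773), (7827, 1454), (7829, 4664), (7669, 4895), (803, 7049),
      (-1386, 5263)]),
    (5, [(7827, 1454), (9586, 1627), (10942, 3068), (7829, 4664)]),
    (5, [(16895, 5661), (17842, 5263), (20031, 7049), (19049, 8431), (16906, 8644)]),
    (5, [(9151, 11939), (11769, 13003), (11880, 13999), (9251, 15446), (8408, 13493)]),
    (5, [(20821, 12251), (23436, 13793), (21101, 14774)])]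

/-- A tiling whose tiles of color `5` have diameter below `0.418` and mutual distances above
`0.657`, in units of `10000`. -/
def sixColoringWide : PeriodicTiling where
  width := 19964
  shift := 79
  height := 33953
  tiles := [
    (0, [(3710, 11498), (7558, 6936), (10223, 6642), (12894, 8332), (13089, 14916),
      (10586, 16448), (4549, 13811)]),
    (0, [(13732, 28474), (17580, 23912), (20661, 23442), (22916, 25309), (23111, 31893),
      (20607, 33425), (14571, 30788)]),
    (1, [(12033, -1644), (14492, -3165), (20528, -528), (21412, 1775), (17558, 6335),
      (14382, 6817), (12177, 4941)]),
    (1, [(2090, 15332), (4549, 13811), (10586, 16448), (11469, 18751), (7615, 23312),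
      (4440, 23794), (2235, 21918)]),
    (2, [(12894, 8332), (14382, 6817), (17558, 6335), (21431, 11217), (20778, 14456),
      (14325, 15780), (13089, 14916)]),
    (2, [(2952, 25309), (4440, 23794), (7615, 23312), (11676, 28199), (10836, 31432),
      (4383, 32757), (3147, 31893)]),
    (3, [(4304, -1196), (10757, -2521), (12033, -1644), (12177, 4941), (10223, 6642),
      (7558, 6936), (2770, 1599)]),
    (3, [(14325, 15780), (20778, 14456), (22054, 15332), (22199, 21918), (20661, 23442),
      (17580, 23912), (13348, 19069)]),
    (4, [(1448, 1775), (2770, 1599), (7558, 6936), (3710, 11498), (1467, 11217), (-2406, 6335)]),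
    (4, [(11469, 18751), (13348, 19069), (17580, 23912), (13732, 28474), (11676, 28199),
      (7615, 23312)]),
    (5, [(564, -528), (3068, -2060), (4304, -1196), (2770, 1599), (1448, 1775)]),
    (5, [(12177, 4941), (14382, 6817), (12894, 8332), (10223, 6642)]),
    (5, [(1467, 11217), (3710, 11498), (4549, 13811), (2090, 15332), (814, 14456)]),
    (5, [(13089, 14916), (14325, 15780), (13348, 19069), (11469, 18751), (10586, 16448)]),
    (5, [(2235, 21918), (4440, 23794), (2952, 25309), (697, 23442)]),
    (5, [(11676, 28199), (13732, 28474), (14571, 30788), (12112, 32309), (10836, 31432)])]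

lemma edgeMatched_sixColoringNarrow : sixColoringNarrow.EdgeMatched 2 where
  width_pos := by decide
  height_pos := by decide
  ne_nil := by decide +kernel
  area_pos := by decide +kernel
  exists_match := by decide +kernel

lemma edgeMatched_sixColoringWide : sixColoringWide.EdgeMatched 2 where
  width_pos := by decide
  height_pos := by decide
  ne_nil := by decide +kernel
  area_pos := by decide +kernel
  exists_match := by decide +kernel

lemma separated_sixColoringNarrow :
    sixColoringNarrow.Separated (fun i => if i = 5 then (3540, 4180) else (10000, 10000)) 1 1 where
  width_pos := by decide
  height_pos := by decide
  forbidden_nonneg := by decide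
  lt_height := by decide +kernel
  lt_width := by decide +kernel
  avoids := by decide +kernel

lemma separated_sixColoringWide :
    sixColoringWide.Separated (fun i => if i = 5 then (4180, 6570) else (10000, 10000)) 1 1 where
  width_pos := by decide
  height_pos := by decide
  forbidden_nonneg := by decide
  lt_height := by decide +kernel
  lt_width := by decide +kernel
  avoids := by decide +kernel

theorem mainTheorem2 :
    (∀ d ∈ Set.Icc (0.354 : ℝ) 0.657,
      ∃ c : Plane → Fin 6, HasColoringType c ![1, 1, 1, 1, 1, d]) ∧
    (∃ c : ℝ → Plane → Fin 6, ∀ d ∈ Set.Icc (0.354 : ℝ) 0.553,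
      HasColoringType (c d) ![1, 1, 1, 1, 1, d]) ∧
    (∃ c : Plane → Fin 6, ∀ d ∈ Set.Icc (0.418 : ℝ) 0.657,
      HasColoringType c ![1, 1, 1, 1, 1, d]) ∧
    Set.Icc (√2 - 1) (1 / √5) ⊂ Set.Icc (0.354 : ℝ) 0.657 := by
  obtain ⟨c₁, h₁⟩ := PeriodicTiling.exists_coloring edgeMatched_sixColoringNarrow
    separated_sixColoringNarrow
  obtain ⟨c₂, h₂⟩ := PeriodicTiling.exists_coloring edgeMatched_sixColoringWide
    separated_sixColoringWide
  norm_num [-Set.mem_Icc] at h₁ h₂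
  have key : ∀ d ∈ Set.Icc (0.354 : ℝ) 0.657,
      HasColoringType (if d ≤ 0.418 then c₁ else c₂) ![1, 1, 1, 1, 1, d] := by
    rintro d ⟨hd₁, hd₂⟩
    split_ifs with hd
    · exact h₁ d ⟨by linarith, by linarith⟩
    · exact h₂ d ⟨by linarith, by linarith⟩
  refine ⟨fun d hd => ⟨_, key d hd⟩, ⟨fun d => if d ≤ 0.418 then c₁ else c₂, fun d hd =>
    key d ⟨hd.1, hd.2.trans (by norm_num)⟩⟩, ⟨c₂, fun d hd => h₂ d ⟨?_, ?_⟩⟩, ?_⟩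
  · linarith [hd.1]
  · linarith [hd.2]
  have s₂ : (1.414 : ℝ) < √2 := Real.lt_sqrt_of_sq_lt (by norm_num)
  have s₅ : (2 : ℝ) < √5 := Real.lt_sqrt_of_sq_lt (by norm_num)
  have s₅' : 1 / √5 < 1 / 2 := one_div_lt_one_div_of_lt (by norm_num) s₅
  refine Set.ssubset_iff_subset_ne.2 ⟨Set.Icc_subset_Icc (by linarith) (by linarith), fun e => ?_⟩
  -- The right endpoint witnesses properness, since 1/√5 < 1/2.
  have : (0.657 : ℝ) ∈ Set.Icc (√2 - 1) (1 / √5) := e ▸ ⟨by norm_num, le_rfl⟩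
  linarith [this.2]
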